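/- Let $A$ and $B$ be unital C*-algebras that are strongly Morita equivalent with respect to an $A$-$B$-equivalence bimodule $X$ (a complete full left Hilbert $A$-module and full right Hilbert $B$-module with commuting, adjointable actions satisfying ${}_A\langle x,y\rangle\cdot z=x\cdot\langle y,z\rangle_B$). Let $\{u_i\}_{i=1}^n$ be a finite left $A$-basis of $X$, that is, $x=\sum_{i=1}^n {}_A\langle x,u_i\rangle\cdot u_i$ for all $x\in X$. Let $\mathcal K$ be a complex Hilbert space and $\psi:B\to\mathbf B(\mathcal K)$ a completely positive linear map. Identify $\mathcal K\otimes\mathbf C^n$ with the Hilbert space direct sum $\mathcal K^n$, so that operators on it are $n\times n$ matrices over $\mathbf B(\mathcal K)$, and define $\phi:A\to\mathbf B(\mathcal K\otimes\mathbf C^n)$ by $$\bigl[\phi(a)_{ij}\bigr]_{i,j=1}^n=\bigl[\psi(\langle u_i,\,a\cdot u_j\rangle_B)\bigr]_{i,j=1}^n\qquad(a\in A).$$ Then $\phi$ is a completely positive linear map, and $\phi$ is strongly Morita equivalent to $\psi$. Here the following definitions are used. A minimal Stinespring representation of a completely positive linear map $\theta:C\to\mathbf B(\mathcal L)$ on a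 C*-algebra $C$ is a triple $(\pi_\theta,V_\theta,\mathcal H_\theta)$ of a Hilbert space $\mathcal H_\theta$, a $*$-representation $\pi_\theta$ of $C$ on $\mathcal H_\theta$ and $V_\theta\in\mathbf B(\mathcal L,\mathcal H_\theta)$ such that $\theta(c)=V_\theta^*\pi_\theta(c)V_\theta$ for all $c\in C$ and the linear span of $\pi_\theta(C)V_\theta\mathcal L$ is dense in $\mathcal H_\theta$. Non-degenerate representations $\pi_A:A\to\mathbf B(\mathcal H)$ and $\pi_B:B\to\mathbf B(\mathcal L)$ are strongly Morita equivalent if there are an $A$-$B$-equivalence bimodule $Y$ and a linear map $\pi_Y:Y\to\mathbf B(\mathcal L,\mathcal H)$ with $\pi_Y(x)\pi_Y(y)^*=\pi_A({}_A\langle x,y\rangle)$, $\pi_Y(x)^*\pi_Y(y)=\pi_B(\langle x,y\rangle_B)$ and $\pi_Y(a\cdot x\cdot b)=\pi_A(a)\pi_Y(x)\pi_B(b)$ for all $a\in A$, $b\in B$, $x,y\in Y$. Finally, $\phi$ is strongly Morita equivalent to $\psi$ if a minimal Stinespring representation of $\phi$ is strongly Morita equivalent to one of $\psi$. -/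

import Mathlib

open scoped CStarAlgebra

universe u v w t t₁ t₂

/-- The structure of an `A`-`B`-equivalence bimodule (imprimitivity bimodule) on `X`, for unital
C*-algebras `A` and `B`. The left action of `A` is `a • x`; the right action of `B` is written
through the opposite algebra, `x · b = MulOpposite.op b • x`. The space `X` is a full left Hilbert
`A`-module for `leftInner` (linear in the first variable), a full right Hilbert `B`-module for
`rightInner` (linear in the second variable), complete for the norm given by either of them, and the
two inner products are linked by `⟨x, y⟩_A · z = x · ⟨y, z⟩_B`. -/
structure EquivalenceBimodule (A : Type u) (B : Type v) (X : Type w)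
    [CStarAlgebra A] [PartialOrder A] [StarOrderedRing A]
    [CStarAlgebra B] [PartialOrder B] [StarOrderedRing B]
    [NormedAddCommGroup X] [NormedSpace ℂ X] [Module A X] [Module Bᵐᵒᵖ X] where
  /-- the left inner product, with values in `A` -/
  leftInner : X → X → A
  /-- the right inner product, with values in `B` -/
  rightInner : X → X → B
  complete : CompleteSpace X
  -- compatibility of the actions with each other and with the complex scalars
  smul_comm : ∀ (a : A) (b : B) (x : X),
    a • (MulOpposite.op b • x) = MulOpposite.op b • (a • x)
  complex_smul_left : ∀ (c : ℂ) (a : A) (x : X), (c • a) • x = c • (a • x)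
  complex_smul_right : ∀ (c : ℂ) (b : B) (x : X),
    MulOpposite.op (c • b) • x = c • (MulOpposite.op b • x)
  -- left Hilbert `A`-module
  left_add : ∀ x y z : X, leftInner (x + y) z = leftInner x z + leftInner y z
  left_smul : ∀ (a : A) (x y : X), leftInner (a • x) y = a * leftInner x y
  left_star : ∀ x y : X, star (leftInner x y) = leftInner y x
  left_nonneg : ∀ x : X, 0 ≤ leftInner x x
  left_norm : ∀ x : X, ‖x‖ ^ 2 = ‖leftInner x x‖
  left_full : Dense (Submodule.span ℂ {a : A | ∃ x y : X, leftInner x y = a} : Set A)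
  -- right Hilbert `B`-module
  right_add : ∀ x y z : X, rightInner x (y + z) = rightInner x y + rightInner x z
  right_smul : ∀ (b : B) (x y : X), rightInner x (MulOpposite.op b • y) = rightInner x y * b
  right_star : ∀ x y : X, star (rightInner x y) = rightInner y x
  right_nonneg : ∀ x : X, 0 ≤ rightInner x x
  right_norm : ∀ x : X, ‖x‖ ^ 2 = ‖rightInner x x‖
  right_full : Dense (Submodule.span ℂ {b : B | ∃ x y : X, rightInner x y = b} : Set B)
  -- both actions are by adjointable operators, and the inner products are linked
  right_adjoint : ∀ (a : A) (x y : X), rightInner (a • x) y = rightInner x (star a • y)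
  left_adjoint : ∀ (b : B) (x y : X),
    leftInner (MulOpposite.op b • x) y = leftInner x (MulOpposite.op (star b) • y)
  linking : ∀ x y z : X, leftInner x y • z = MulOpposite.op (rightInner y z) • x

/-- A finite family `u` in `X` is a left `A`-basis: `x = ∑ i, ⟨x, u i⟩_A · u i` for all `x`. -/
def EquivalenceBimodule.IsLeftBasis {A : Type u} {B : Type v} {X : Type w}
    [CStarAlgebra A] [PartialOrder A] [StarOrderedRing A]
    [CStarAlgebra B] [PartialOrder B] [StarOrderedRing B]
    [NormedAddCommGroup X] [NormedSpace ℂ X] [Module A X] [Module Bᵐᵒᵖ X]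
    (E : EquivalenceBimodule A B X) {n : ℕ} (u : Fin n → X) : Prop :=
  ∀ x : X, x = ∑ i, E.leftInner x (u i) • u i

/-- A representation `π` of `A` on a Hilbert space `H` is non-degenerate: the vectors `π a ξ` span
a dense subspace of `H`. -/
def IsNondegenerateRep {A : Type u} [CStarAlgebra A]
    {H : Type t} [NormedAddCommGroup H] [InnerProductSpace ℂ H] [CompleteSpace H]
    (π : A →⋆ₙₐ[ℂ] (H →L[ℂ] H)) : Prop :=
  Dense (Submodule.span ℂ {η : H | ∃ (a : A) (ξ : H), π a ξ = η} : Set H)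

/-- `(πA, πX, πB)` is a representation of the equivalence bimodule `X` on the pair of Hilbert spaces
`(H, K)`. -/
structure EquivalenceBimodule.IsRepresentation {A : Type u} {B : Type v} {X : Type w}
    [CStarAlgebra A] [PartialOrder A] [StarOrderedRing A]
    [CStarAlgebra B] [PartialOrder B] [StarOrderedRing B]
    [NormedAddCommGroup X] [NormedSpace ℂ X] [Module A X] [Module Bᵐᵒᵖ X]
    (E : EquivalenceBimodule A B X)
    {H : Type t₁} [NormedAddCommGroup H] [InnerProductSpace ℂ H] [CompleteSpace H]
    {K : Type t₂} [NormedAddCommGroup K] [InnerProductSpace ℂ K] [CompleteSpace K]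
    (πA : A →⋆ₙₐ[ℂ] (H →L[ℂ] H)) (πX : X →ₗ[ℂ] (K →L[ℂ] H)) (πB : B →⋆ₙₐ[ℂ] (K →L[ℂ] K)) :
    Prop where
  nondegenerate_left : IsNondegenerateRep πA
  nondegenerate_right : IsNondegenerateRep πB
  comp_adjoint : ∀ x y : X,
    (πX x).comp (ContinuousLinearMap.adjoint (πX y)) = πA (E.leftInner x y)
  adjoint_comp : ∀ x y : X,
    (ContinuousLinearMap.adjoint (πX x)).comp (πX y) = πB (E.rightInner x y)
  map_actions : ∀ (a : A) (x : X) (b : B),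
    πX (a • (MulOpposite.op b • x)) = (πA a).comp ((πX x).comp (πB b))

/-- Strong Morita equivalence of non-degenerate representations of `A` and `B`: they are the two
outer parts of a representation of some `A`-`B`-equivalence bimodule. (The universe `w` is that of
the bimodule.) -/
def RepStronglyMoritaEquivalent {A : Type u} {B : Type v}
    [CStarAlgebra A] [PartialOrder A] [StarOrderedRing A]
    [CStarAlgebra B] [PartialOrder B] [StarOrderedRing B]
    {H : Type t₁} [NormedAddCommGroup H] [InnerProductSpace ℂ H] [CompleteSpace H]
    {K : Type t₂} [NormedAddCommGroup K] [InnerProductSpace ℂ K] [CompleteSpace K]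
    (πA : A →⋆ₙₐ[ℂ] (H →L[ℂ] H)) (πB : B →⋆ₙₐ[ℂ] (K →L[ℂ] K)) : Prop :=
  ∃ (X : Type w) (_ : NormedAddCommGroup X) (_ : NormedSpace ℂ X)
    (_ : Module A X) (_ : Module Bᵐᵒᵖ X) (E : EquivalenceBimodule A B X)
    (πX : X →ₗ[ℂ] (K →L[ℂ] H)), E.IsRepresentation πA πX πB

/-- `(π, V, H)` is a minimal Stinespring representation of `φ : A → 𝐁(K)`: one has
`φ a = V* π(a) V`, and the vectors `π(a) V ξ` span a dense subspace of `H`. -/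
structure IsMinimalStinespring {A : Type u}
    [CStarAlgebra A] [PartialOrder A] [StarOrderedRing A]
    {K : Type t₁} [NormedAddCommGroup K] [InnerProductSpace ℂ K] [CompleteSpace K]
    (φ : A →CP (K →L[ℂ] K))
    {H : Type t₂} [NormedAddCommGroup H] [InnerProductSpace ℂ H] [CompleteSpace H]
    (π : A →⋆ₙₐ[ℂ] (H →L[ℂ] H)) (V : K →L[ℂ] H) : Prop where
  dilation : ∀ a : A, φ a = (ContinuousLinearMap.adjoint V).comp ((π a).comp V)
  minimal : Dense (Submodule.span ℂ {η : H | ∃ (a : A) (ξ : K), π a (V ξ) = η} : Set H)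

/-- Strong Morita equivalence of completely positive maps: a minimal Stinespring representation of
`φ` is strongly Morita equivalent to one of `ψ`. The Hilbert spaces are taken in the universes in
which the Stinespring construction (a completion of a quotient of `A ⊗ H`) lives; minimal
Stinespring representations are unique up to unitary equivalence. -/
def CPStronglyMoritaEquivalent {A : Type u} {B : Type v}
    [CStarAlgebra A] [PartialOrder A] [StarOrderedRing A]
    [CStarAlgebra B] [PartialOrder B] [StarOrderedRing B]
    {H : Type t₁} [NormedAddCommGroup H] [InnerProductSpace ℂ H] [CompleteSpace H]
    {K : Type t₂} [NormedAddCommGroup K] [InnerProductSpace ℂ K] [CompleteSpace K]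
    (φ : A →CP (H →L[ℂ] H)) (ψ : B →CP (K →L[ℂ] K)) : Prop :=
  ∃ (Hφ : Type (max u t₁)) (_ : NormedAddCommGroup Hφ) (_ : InnerProductSpace ℂ Hφ)
    (_ : CompleteSpace Hφ) (πφ : A →⋆ₙₐ[ℂ] (Hφ →L[ℂ] Hφ)) (Vφ : H →L[ℂ] Hφ)
    (Kψ : Type (max v t₂)) (_ : NormedAddCommGroup Kψ) (_ : InnerProductSpace ℂ Kψ)
    (_ : CompleteSpace Kψ) (πψ : B →⋆ₙₐ[ℂ] (Kψ →L[ℂ] Kψ)) (Vψ : K →L[ℂ] Kψ),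
    IsMinimalStinespring φ πφ Vφ ∧ IsMinimalStinespring ψ πψ Vψ ∧
      RepStronglyMoritaEquivalent.{u, v, w} πφ πψ

/-- The bounded operator on `K ⊗ ℂⁿ = Kⁿ` (Hilbert space direct sum) whose operator matrix is
`[T i j]`. -/
noncomputable def operatorOfMatrix {n : ℕ}
    {K : Type t} [NormedAddCommGroup K] [InnerProductSpace ℂ K]
    (T : Fin n → Fin n → (K →L[ℂ] K)) :
    PiLp 2 (fun _ : Fin n => K) →L[ℂ] PiLp 2 (fun _ : Fin n => K) :=
  ((PiLp.continuousLinearEquiv 2 ℂ (fun _ : Fin n => K)).symm :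
      (Fin n → K) →L[ℂ] PiLp 2 (fun _ : Fin n => K)).comp
    (ContinuousLinearMap.pi fun i =>
      ∑ j, (T i j).comp (PiLp.proj 2 (fun _ : Fin n => K) j))

theorem operatorOfMatrix_apply {n : ℕ}
    {K : Type t} [NormedAddCommGroup K] [InnerProductSpace ℂ K]
    (T : Fin n → Fin n → (K →L[ℂ] K)) (ξ : PiLp 2 (fun _ : Fin n => K)) (i : Fin n) :
    operatorOfMatrix T ξ i = ∑ j, T i j (ξ j) := by
  simp [operatorOfMatrix]

/-! Let `(ρ, U, L)` be a minimal Stinespring representation of `ψ`. Then `A` acts on the interior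
tensor product of `X` and `L` over `B`, where `⟪x ⊗ U ξ, y ⊗ U η⟫ = ⟪ξ, ψ ⟨x, y⟩ η⟫`. The column map
`(ξ i) ↦ ∑ u i ⊗ U (ξ i)` dilates `φ`, and it is minimal because the vectors `a · u i` span `X`. So
the representation of `φ` is induced from that of `ψ` through `X`, and `x ↦ (ℓ ↦ x ⊗ ℓ)` represents
`X`.

The tensor product itself is not built. In any minimal dilation `(π, V, H)` of `φ`, with `W i` the
columns of `V`, the operator `T x = ∑ π ⟨x, u i⟩ W i` plays the role of `ξ ↦ x ⊗ U ξ`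
(`inner_tensorOperator`), and `exists_isRepresentation` extends it from `K` to `L`. Complete
positivity of `φ` comes from `matrix_rightInner_nonneg`: a positive matrix over `A`, squeezed
between vectors of `X`, is a positive matrix over `B`. Dilations exist because `θ (s⋆ r)` is a
positive kernel. -/

open scoped InnerProductSpace

/-! ### Positivity of matrices over a C⋆-algebra -/

/-- The square root of the negative part of a self-adjoint element `a` detects whether
`a` is nonnegative. -/
theorem CStarAlgebra.exists_star_mul_self_conj_eq_neg {D : Type*} [NonUnitalCStarAlgebra D]
    [PartialOrder D] [StarOrderedRing D] (a : D) (ha : IsSelfAdjoint a) :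
    ∃ N R : D, star N = N ∧ N * a * N = -(star (R * N) * (R * N)) ∧ (R * N = 0 → 0 ≤ a) := by
  have hN : 0 ≤ a⁻ := CFC.negPart_nonneg a
  obtain ⟨R, hR⟩ := CStarAlgebra.nonneg_iff_eq_star_mul_self.mp hN
  have hNs : star a⁻ = a⁻ := (IsSelfAdjoint.of_nonneg hN).star_eq
  refine ⟨a⁻, R, hNs, ?_, fun hzero => ?_⟩
  -- With `N = a⁻ = R⋆ R` and `N a⁺ = 0`, one gets `N a N = -N³ = -(R N)⋆ (R N)`.
  · have h1 : a⁻ * a = -(a⁻ * a⁻) := by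
      conv_lhs => enter [2]; rw [← CFC.posPart_sub_negPart a ha]
      rw [mul_sub, CFC.negPart_mul_posPart, zero_sub]
    rw [h1, star_mul, hNs, neg_mul]
    congr 1
    rw [mul_assoc a⁻ (star R), ← mul_assoc (star R) R, ← hR, mul_assoc]
  · have hN0 : a⁻ = 0 := by
      rw [← CStarRing.star_mul_self_eq_zero_iff, hNs]
      conv_lhs => enter [1]; rw [hR]
      rw [mul_assoc, hzero, mul_zero]
    exact (CFC.negPart_eq_zero_iff a ha).mp hN0

theorem CStarAlgebra.exists_eq_star_mul_self {D : Type*} [NonUnitalCStarAlgebra D]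
    [PartialOrder D] [StarOrderedRing D] {a : D} (ha : 0 ≤ a) : ∃ b : D, a = star b * b :=
  CStarAlgebra.nonneg_iff_eq_star_mul_self.mp ha

/-- A self-adjoint matrix over a C⋆-algebra all of whose quadratic form values are nonnegative is
nonnegative. -/
theorem CStarMatrix.nonneg_of_forall_sum_nonneg {B : Type v} [CStarAlgebra B] [PartialOrder B]
    [StarOrderedRing B] {ι : Type*} [Fintype ι] (M : CStarMatrix ι ι B) (hM : IsSelfAdjoint M)
    (h : ∀ v : ι → B, 0 ≤ ∑ i, ∑ j, star (v i) * M i j * v j) : 0 ≤ M := by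
  obtain ⟨N, R, hNs, hcube, hM0⟩ := CStarAlgebra.exists_star_mul_self_conj_eq_neg M hM
  -- The `i`-th diagonal entry of `N M N` is the form at the `i`-th column of `N`, hence
  -- nonnegative; it also equals minus a sum of squares of entries of `R N`, which must therefore
  -- vanish.
  have hzero : R * N = 0 := by
    ext m i
    have hi := h fun k => N k i
    have hsum : ∑ k, ∑ l, star (N k i) * M k l * N l i = (N * M * N) i i := by
      simp only [CStarMatrix.mul_apply, Finset.sum_mul]
      rw [Finset.sum_comm]
      refine Finset.sum_congr rfl fun l _ => Finset.sum_congr rfl fun k _ => ?_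
      rw [← CStarMatrix.star_apply, hNs]
    rw [hsum, hcube, CStarMatrix.neg_apply, neg_nonneg] at hi
    have hexp : (star (R * N) * (R * N)) i i =
        ∑ k, star ((R * N) k i) * (R * N) k i := by
      simp only [CStarMatrix.mul_apply (M := star (R * N)), CStarMatrix.star_apply]
    rw [hexp] at hi
    have hall := (Finset.sum_eq_zero_iff_of_nonneg
      (fun k _ => star_mul_self_nonneg ((R * N) k i))).mp
      (le_antisymm hi (Finset.sum_nonneg fun k _ => star_mul_self_nonneg _)) m (Finset.mem_univ m)
    simpa using (CStarRing.star_mul_self_eq_zero_iff _).mp hall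
  exact hM0 hzero

/-- Writing `T = N⋆ N` turns the form into `∑ m, ‖∑ i, N m i (ξ i)‖²`. -/
theorem CStarMatrix.re_sum_inner_nonneg {L : Type t} [NormedAddCommGroup L]
    [InnerProductSpace ℂ L] [CompleteSpace L] {ι : Type*} [Fintype ι]
    {T : CStarMatrix ι ι (L →L[ℂ] L)} (hT : 0 ≤ T) (ξ : ι → L) :
    0 ≤ (∑ i, ∑ j, ⟪ξ i, T i j (ξ j)⟫_ℂ).re := by
  obtain ⟨N, rfl⟩ := CStarAlgebra.exists_eq_star_mul_self hT
  have : ∑ i, ∑ j, ⟪ξ i, (star N * N) i j (ξ j)⟫_ℂ =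
      ∑ m, ⟪∑ i, N m i (ξ i), ∑ j, N m j (ξ j)⟫_ℂ := by
    simp only [CStarMatrix.mul_apply, CStarMatrix.star_apply, sum_apply,
      inner_sum, sum_inner, ContinuousLinearMap.star_eq_adjoint, mul_apply_eq_comp,
      ContinuousLinearMap.adjoint_inner_right]
    rw [Finset.sum_comm]
    conv_rhs => rw [Finset.sum_comm]
    refine Finset.sum_congr rfl fun i _ => ?_
    rw [Finset.sum_comm]
  rw [this, Complex.re_sum]
  exact Finset.sum_nonneg fun m _ => inner_self_nonneg (𝕜 := ℂ)

/-- The operator `∑ (v i)⋆ T i j (v j)`, evaluated at `η`, gives the scalar form at the vectors `v i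
η`. -/
theorem CStarMatrix.nonneg_of_re_sum_inner_nonneg {L : Type t} [NormedAddCommGroup L]
    [InnerProductSpace ℂ L] [CompleteSpace L] {ι : Type*} [Fintype ι]
    {T : CStarMatrix ι ι (L →L[ℂ] L)} (hT : IsSelfAdjoint T)
    (h : ∀ ξ : ι → L, 0 ≤ (∑ i, ∑ j, ⟪ξ i, T i j (ξ j)⟫_ℂ).re) : 0 ≤ T := by
  refine nonneg_of_forall_sum_nonneg T hT fun v => ?_
  rw [ContinuousLinearMap.nonneg_iff_isPositive, ContinuousLinearMap.isPositive_def']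
  constructor
  · rw [isSelfAdjoint_iff]
    simp only [star_sum, star_mul, star_star]
    rw [Finset.sum_comm]
    refine Finset.sum_congr rfl fun i _ => Finset.sum_congr rfl fun j _ => ?_
    rw [← CStarMatrix.star_apply, hT.star_eq, mul_assoc]
  · intro η
    rw [ContinuousLinearMap.reApplyInnerSelf_apply, inner_re_symm]
    simpa [sum_apply, inner_sum, ContinuousLinearMap.star_eq_adjoint,
      ContinuousLinearMap.adjoint_inner_right] using h fun i => v i η

/-- Complete positivity in terms of vectors. -/
theorem CompletelyPositiveMap.re_sum_inner_nonneg {C : Type u} [CStarAlgebra C] [PartialOrder C]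
    [StarOrderedRing C] {L : Type t} [NormedAddCommGroup L] [InnerProductSpace ℂ L]
    [CompleteSpace L] (θ : C →CP (L →L[ℂ] L)) {ι : Type*} [Fintype ι] {M : CStarMatrix ι ι C}
    (hM : 0 ≤ M) (ξ : ι → L) : 0 ≤ (∑ i, ∑ j, ⟪ξ i, θ (M i j) (ξ j)⟫_ℂ).re :=
  CStarMatrix.re_sum_inner_nonneg (θ.map_cstarMatrix_nonneg M hM) ξ

/-! ### Operators determined on total families -/

section TotalFamilies

variable {S S' : Type*} {L L' H H' : Type*}
  [NormedAddCommGroup L] [InnerProductSpace ℂ L]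
  [NormedAddCommGroup L'] [InnerProductSpace ℂ L']
  [NormedAddCommGroup H] [InnerProductSpace ℂ H]
  [NormedAddCommGroup H'] [InnerProductSpace ℂ H']

/-- A family of operators `V s : L → H` is total if the ranges of its members span a dense
subspace of `H`. -/
def IsTotalFamily (V : S → L →L[ℂ] H) : Prop :=
  Dense (Submodule.span ℂ {η : H | ∃ (s : S) (ξ : L), V s ξ = η} : Set H)

/-- The linear combination map `∑ ξ s ↦ ∑ V s (ξ s)` of a family of operators. -/
noncomputable def familySum (V : S → L →L[ℂ] H) : (S →₀ L) →ₗ[ℂ] H :=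
  Finsupp.lsum ℂ fun s => (V s).toLinearMap

theorem familySum_apply (V : S → L →L[ℂ] H) (x : S →₀ L) :
    familySum V x = x.sum fun s ξ => V s ξ := by
  simp [familySum]

theorem familySum_single (V : S → L →L[ℂ] H) (s : S) (ξ : L) :
    familySum V (Finsupp.single s ξ) = V s ξ := by
  simp [familySum]

theorem comp_familySum (V : S → L →L[ℂ] H) (T : H →L[ℂ] H') (x : S →₀ L) :
    T (familySum V x) = familySum (fun s => T ∘L V s) x := by
  simp [familySum_apply, map_finsuppSum]

theorem inner_familySum (V : S → L →L[ℂ] H) (W : S' → L' →L[ℂ] H) (x : S →₀ L) (y : S' →₀ L') :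
    ⟪familySum V x, familySum W y⟫_ℂ =
      ∑ s ∈ x.support, ∑ r ∈ y.support, ⟪V s (x s), W r (y r)⟫_ℂ := by
  simp only [familySum_apply, Finsupp.sum, sum_inner, inner_sum]
  exact Finset.sum_comm

theorem IsTotalFamily.denseRange {V : S → L →L[ℂ] H} (hV : IsTotalFamily V) :
    DenseRange (familySum V) := by
  refine hV.mono (SetLike.coe_subset_coe.mpr
    (Submodule.span_le.mpr ?_ : _ ≤ LinearMap.range (familySum V)))
  rintro _ ⟨s, ξ, rfl⟩
  exact ⟨Finsupp.single s ξ, familySum_single V s ξ⟩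

/-- The bound makes `V s ξ ↦ W s ξ` well defined and continuous on a dense span. Both the
Stinespring representation and the operators representing `X` arise this way. -/
theorem IsTotalFamily.exists_extension [CompleteSpace H'] {V : S → L →L[ℂ] H}
    (hV : IsTotalFamily V) (W : S → L →L[ℂ] H') (C : ℝ)
    (h : ∀ x, ‖familySum W x‖ ≤ C * ‖familySum V x‖) :
    ∃ T : H →L[ℂ] H', ∀ s ξ, T (V s ξ) = W s ξ := by
  refine ⟨(familySum W).extendOfNorm (familySum V), fun s ξ => ?_⟩
  have := LinearMap.extendOfNorm_eq hV.denseRange ⟨C, h⟩ (Finsupp.single s ξ)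
  rwa [familySum_single, familySum_single] at this

theorem IsTotalFamily.ext {V : S → L →L[ℂ] H} (hV : IsTotalFamily V) {T T' : H →L[ℂ] H'}
    (h : ∀ s ξ, T (V s ξ) = T' (V s ξ)) : T = T' := by
  refine ContinuousLinearMap.ext_on hV ?_
  rintro _ ⟨s, ξ, rfl⟩
  exact h s ξ

theorem IsTotalFamily.eq_of_inner {V : S → L →L[ℂ] H} (hV : IsTotalFamily V) {x y : H}
    (h : ∀ s ξ, ⟪x, V s ξ⟫_ℂ = ⟪y, V s ξ⟫_ℂ) : x = y := by
  have := hV.ext (T := innerSL ℂ x) (T' := innerSL ℂ y) (by simpa using h)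
  exact ext_inner_right ℂ fun z => by simpa using congrArg (fun f => f z) this

theorem IsTotalFamily.ext_inner {V : S → L →L[ℂ] H} (hV : IsTotalFamily V)
    {W : S' → L' →L[ℂ] H'} (hW : IsTotalFamily W) {T T' : H →L[ℂ] H'}
    (h : ∀ s ξ r η, ⟪T (V s ξ), W r η⟫_ℂ = ⟪T' (V s ξ), W r η⟫_ℂ) : T = T' :=
  hV.ext fun s ξ => hW.eq_of_inner fun r η => h s ξ r η

end TotalFamilies

/-! ### Stinespring dilation from a positive kernel -/

section Stinespring

variable {C : Type u} [CStarAlgebra C] [PartialOrder C] [StarOrderedRing C]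
  {L : Type t} [NormedAddCommGroup L] [InnerProductSpace ℂ L] [CompleteSpace L]

/-- The form at `v` is the square `(∑ s i v i)⋆ (∑ s j v j)`. -/
theorem CStarMatrix.star_mul_nonneg {ι : Type*} [Fintype ι] (s : ι → C) :
    0 ≤ CStarMatrix.ofMatrix (Matrix.of fun i j => star (s i) * s j) := by
  refine CStarMatrix.nonneg_of_forall_sum_nonneg _ ?_ fun v => ?_
  · ext i j
    simp [CStarMatrix.star_apply]
  · have : ∑ i, ∑ j, star (v i) * (star (s i) * s j) * v j =
        star (∑ i, s i * v i) * ∑ j, s j * v j := by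
      simp only [star_sum, star_mul, Finset.sum_mul, Finset.mul_sum, mul_assoc]
      exact Finset.sum_comm
    simpa [this] using star_mul_self_nonneg (∑ i, s i * v i)

/-- The operator valued kernel `(s, t) ↦ θ (s⋆ t)` of a completely positive map. -/
noncomputable def CompletelyPositiveMap.kernel (θ : C →CP (L →L[ℂ] L)) : Matrix C C (L →L[ℂ] L) :=
  Matrix.of fun s r => θ (star s * r)

theorem CompletelyPositiveMap.kernel_posSemidef (θ : C →CP (L →L[ℂ] L)) :
    θ.kernel.PosSemidef := by
  suffices h : θ.kernel.IsHermitian ∧ ∀ x : C →₀ L,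
      0 ≤ (x.sum fun s ξ => x.sum fun r η => ⟪θ (star r * s) ξ, η⟫_ℂ).re from
    ((RKHS.posSemidef_tfae (K := θ.kernel)).out 0 2).mpr h
  refine ⟨?_, fun x => ?_⟩
  · ext1 s r
    simp [kernel, ← map_star θ]
  · have h := θ.re_sum_inner_nonneg (CStarMatrix.star_mul_nonneg fun i : x.support => (i : C))
      fun i => x i
    simp only [CStarMatrix.ofMatrix_apply, Matrix.of_apply] at h
    -- The kernel criterion has the two arguments of the inner product exchanged; conjugation does
    -- not change the real part.
    rw [← Complex.conj_re, map_sum, Finset.sum_congr rfl fun i _ => map_sum _ _ _,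
      Finset.sum_comm] at h
    simpa only [Finsupp.sum, inner_conj_symm, ← Finset.sum_coe_sort x.support] using h

/-- The Kolmogorov decomposition of the kernel `(s, t) ↦ θ (s⋆ t)`. -/
theorem CompletelyPositiveMap.exists_isTotalFamily_inner_eq (θ : C →CP (L →L[ℂ] L)) :
    ∃ (H : Type (max u t)) (_ : NormedAddCommGroup H) (_ : InnerProductSpace ℂ H)
      (_ : CompleteSpace H) (V : C → L →L[ℂ] H), IsTotalFamily V ∧
      ∀ (s r : C) (ξ η : L), ⟪V s ξ, V r η⟫_ℂ = ⟪ξ, θ (star s * r) η⟫_ℂ := by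
  have : Fact θ.kernel.PosSemidef := ⟨θ.kernel_posSemidef⟩
  let H := RKHS.OfKernel θ.kernel
  refine ⟨H, inferInstance, inferInstance, inferInstance, RKHS.kerFun H, ?_, fun s r ξ η => ?_⟩
  · have := RKHS.kerFun_dense H
    rwa [← Submodule.dense_iff_topologicalClosure_eq_top] at this
  · rw [← inner_conj_symm, ← RKHS.kernel_inner, RKHS.OfKernel.kernel_ofKernel, inner_conj_symm]
    rfl

/-- Every completely positive map has a minimal Stinespring representation. -/
theorem CompletelyPositiveMap.exists_isMinimalStinespring (θ : C →CP (L →L[ℂ] L)) :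
    ∃ (H : Type (max u t)) (_ : NormedAddCommGroup H) (_ : InnerProductSpace ℂ H)
      (_ : CompleteSpace H) (π : C →⋆ₙₐ[ℂ] (H →L[ℂ] H)) (V : L →L[ℂ] H),
      IsMinimalStinespring θ π V := by
  obtain ⟨H, _, _, _, V, hV, hker⟩ := θ.exists_isTotalFamily_inner_eq
  have hbound (c : C) (x : C →₀ L) :
      ‖familySum (fun s => V (c * s)) x‖ ≤ ‖c‖ * ‖familySum V x‖ := by
    -- Since `c⋆ c ≤ ‖c‖²`, write `‖c‖² - c⋆ c = d⋆ d`. The squared norms for `c` and `d` then add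
    -- up to `‖c‖²` times the original one, and the term for `d` is dropped.
    obtain ⟨d, hd⟩ := CStarAlgebra.exists_eq_star_mul_self
      (sub_nonneg.mpr (CStarAlgebra.star_mul_le_algebraMap_norm_sq (a := c)))
    have hsum : ⟪familySum (fun s => V (c * s)) x, familySum (fun s => V (c * s)) x⟫_ℂ +
        ⟪familySum (fun s => V (d * s)) x, familySum (fun s => V (d * s)) x⟫_ℂ =
        ((‖c‖ ^ 2 : ℝ) : ℂ) * ⟪familySum V x, familySum V x⟫_ℂ := by
      simp only [inner_familySum, hker, Finset.mul_sum, ← Finset.sum_add_distrib]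
      refine Finset.sum_congr rfl fun s _ => Finset.sum_congr rfl fun r _ => ?_
      rw [← inner_add_right, ← add_apply, ← map_add, ← inner_smul_right,
        ← smul_apply, ← map_smul]
      congr 3
      simp only [star_mul, mul_assoc]
      rw [← mul_add, ← mul_assoc (star c), ← mul_assoc (star d), ← hd, ← add_mul,
        add_sub_cancel]
      rw [Algebra.algebraMap_eq_smul_one, smul_one_mul, mul_smul_comm, Complex.coe_smul]
    have hre := congrArg Complex.re hsum
    rw [Complex.add_re, Complex.re_ofReal_mul] at hre
    simp only [← RCLike.re_eq_complex_re, inner_self_eq_norm_sq] at hre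
    refine le_of_sq_le_sq ?_ (by positivity)
    rw [mul_pow, ← hre]
    exact le_add_of_nonneg_right (by positivity)
  choose π hπ using fun c => hV.exists_extension _ _ (hbound c)
  -- Linearity of `s ↦ V s` is recovered from the kernel, by testing against the total family.
  have hadd (s r : C) (ξ : L) : V (s + r) ξ = V s ξ + V r ξ :=
    hV.eq_of_inner fun q η => by
      simp [hker, star_add, add_mul]
  have hsmul (z : ℂ) (s : C) (ξ : L) : V (z • s) ξ = z • V s ξ :=
    hV.eq_of_inner fun q η => by
      simp [hker, star_smul, mul_comm]
  let ρ : C →⋆ₙₐ[ℂ] (H →L[ℂ] H) :=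
    { toFun := π
      map_smul' := fun z c => hV.ext fun s ξ => by simp [hπ, hsmul]
      map_zero' := hV.ext fun s ξ => by
        have h0 := hsmul 0 0 ξ
        rw [zero_smul, zero_smul] at h0
        simp [hπ, h0]
      map_add' := fun c d => hV.ext fun s ξ => by simp [hπ, add_mul, hadd]
      map_mul' := fun c d => hV.ext fun s ξ => by simp [hπ, mul_assoc]
      map_star' := fun c => hV.ext_inner hV fun s ξ r η => by
        rw [ContinuousLinearMap.star_eq_adjoint, ContinuousLinearMap.adjoint_inner_left, hπ, hπ,
          hker, hker, star_mul, star_star, mul_assoc] }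
  -- As `C` is unital, `π a (V 1 ξ) = V a ξ`, so `V 1` generates the whole family.
  refine ⟨H, inferInstance, inferInstance, inferInstance, ρ, V 1, ?_, ?_⟩
  · intro a
    ext ξ
    refine ext_inner_left ℂ fun η => ?_
    change _ = ⟪η, ContinuousLinearMap.adjoint (V 1) (π a (V 1 ξ))⟫_ℂ
    rw [ContinuousLinearMap.adjoint_inner_right, hπ, hker]
    simp
  · have : {η : H | ∃ (a : C) (ξ : L), ρ a (V 1 ξ) = η} = {η : H | ∃ (s : C) (ξ : L), V s ξ = η} := by
      ext η
      refine exists_congr fun a => exists_congr fun ξ => ?_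
      change π a (V 1 ξ) = η ↔ _
      rw [hπ, mul_one]
    rw [this]
    exact hV

theorem IsMinimalStinespring.isTotalFamily {H : Type t₂} [NormedAddCommGroup H]
    [InnerProductSpace ℂ H] [CompleteSpace H] {θ : C →CP (L →L[ℂ] L)}
    {π : C →⋆ₙₐ[ℂ] (H →L[ℂ] H)} {V : L →L[ℂ] H} (h : IsMinimalStinespring θ π V) :
    IsTotalFamily fun c => π c ∘L V := h.minimal

theorem IsMinimalStinespring.inner_eq {H : Type t₂} [NormedAddCommGroup H]
    [InnerProductSpace ℂ H] [CompleteSpace H] {θ : C →CP (L →L[ℂ] L)}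
    {π : C →⋆ₙₐ[ℂ] (H →L[ℂ] H)} {V : L →L[ℂ] H} (h : IsMinimalStinespring θ π V)
    (c d : C) (ξ η : L) : ⟪π c (V ξ), π d (V η)⟫_ℂ = ⟪ξ, θ (star c * d) η⟫_ℂ := by
  rw [h.dilation, map_mul, map_star, ContinuousLinearMap.star_eq_adjoint]
  simp [ContinuousLinearMap.adjoint_inner_right]

/-- Representations are not assumed unital; `π 1` fixes the total set of vectors `π c (V ξ)`. -/
theorem IsMinimalStinespring.map_one {H : Type t₂} [NormedAddCommGroup H]
    [InnerProductSpace ℂ H] [CompleteSpace H] {θ : C →CP (L →L[ℂ] L)}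
    {π : C →⋆ₙₐ[ℂ] (H →L[ℂ] H)} {V : L →L[ℂ] H} (h : IsMinimalStinespring θ π V) :
    π 1 = 1 :=
  h.isTotalFamily.ext fun c ξ => by
    simp [← mul_apply_eq_comp, ← map_mul]

theorem IsMinimalStinespring.isNondegenerateRep {H : Type t₂} [NormedAddCommGroup H]
    [InnerProductSpace ℂ H] [CompleteSpace H] {θ : C →CP (L →L[ℂ] L)}
    {π : C →⋆ₙₐ[ℂ] (H →L[ℂ] H)} {V : L →L[ℂ] H} (h : IsMinimalStinespring θ π V) :
    IsNondegenerateRep π :=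
  by
  refine h.minimal.mono (Submodule.span_mono ?_)
  rintro _ ⟨a, ξ, rfl⟩
  exact ⟨a, V ξ, rfl⟩

end Stinespring

/-! ### Inner products and positivity in the bimodule -/

namespace EquivalenceBimodule

variable {A : Type u} {B : Type v} {X : Type w}
  [CStarAlgebra A] [PartialOrder A] [StarOrderedRing A]
  [CStarAlgebra B] [PartialOrder B] [StarOrderedRing B]
  [NormedAddCommGroup X] [NormedSpace ℂ X] [Module A X] [Module Bᵐᵒᵖ X]
  (E : EquivalenceBimodule A B X)
include E

/-- The scalar `c` acts as the central element `c • 1` of `B`. -/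
theorem op_smul_complex_smul (b : B) (c : ℂ) (x : X) :
    MulOpposite.op b • c • x = c • MulOpposite.op b • x := by
  have h := E.complex_smul_right c 1 x
  rw [MulOpposite.op_one, one_smul] at h
  rw [← h, ← mul_smul, ← MulOpposite.op_mul, smul_one_mul, E.complex_smul_right]

/-- The right inner product is linear in the second variable. -/
def rightInnerₗ (x : X) : X →ₗ[ℂ] B where
  toFun := E.rightInner x
  map_add' := E.right_add x
  map_smul' c y := by
    have h := E.complex_smul_right c 1 y
    rw [MulOpposite.op_one, one_smul] at h
    rw [← h, E.right_smul, mul_smul_one, RingHom.id_apply]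

/-- The left inner product is linear in the first variable. -/
def leftInnerₗ (y : X) : X →ₗ[ℂ] A where
  toFun x := E.leftInner x y
  map_add' x z := E.left_add x z y
  map_smul' c x := by
    have h := E.complex_smul_left c 1 x
    rw [one_smul] at h
    rw [← h, E.left_smul, smul_one_mul, RingHom.id_apply]

theorem rightInner_sum {ι : Type*} (s : Finset ι) (x : X) (f : ι → X) :
    E.rightInner x (∑ i ∈ s, f i) = ∑ i ∈ s, E.rightInner x (f i) :=
  map_sum (E.rightInnerₗ x) f s

theorem rightInner_smul (c : ℂ) (x y : X) : E.rightInner x (c • y) = c • E.rightInner x y :=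
  map_smul (E.rightInnerₗ x) c y

theorem sum_rightInner {ι : Type*} (s : Finset ι) (x : X) (f : ι → X) :
    E.rightInner (∑ i ∈ s, f i) x = ∑ i ∈ s, E.rightInner (f i) x := by
  rw [← E.right_star, rightInner_sum, star_sum]
  exact Finset.sum_congr rfl fun i _ => E.right_star _ _

theorem op_smul_rightInner (b : B) (x y : X) :
    E.rightInner (MulOpposite.op b • x) y = star b * E.rightInner x y := by
  rw [← E.right_star, E.right_smul, star_mul, E.right_star]

/-- With `M = N⋆ N`, the form at `b` is `∑ m, ⟨z m, z m⟩` for `z m = ∑ p, N m (k p) · x p · b p`.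
The map `k` allows repeated rows, so that one index of `M` can be paired with every basis vector. -/
theorem matrix_rightInner_nonneg {κ ι : Type*} [Fintype κ] [Fintype ι] {M : CStarMatrix κ κ A}
    (hM : 0 ≤ M) (k : ι → κ) (x : ι → X) :
    0 ≤ CStarMatrix.ofMatrix
      (Matrix.of fun p q => E.rightInner (x p) (M (k p) (k q) • x q)) := by
  obtain ⟨N, rfl⟩ := CStarAlgebra.exists_eq_star_mul_self hM
  have hentry (p q : ι) (y z : X) : E.rightInner y ((star N * N) (k p) (k q) • z) =
      ∑ m, E.rightInner (N m (k p) • y) (N m (k q) • z) := by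
    simp only [CStarMatrix.mul_apply, Finset.sum_smul, E.rightInner_sum]
    refine Finset.sum_congr rfl fun m _ => ?_
    rw [E.right_adjoint, mul_smul, CStarMatrix.star_apply]
  refine CStarMatrix.nonneg_of_forall_sum_nonneg _ ?_ fun b => ?_
  · ext p q
    simp only [CStarMatrix.star_apply, CStarMatrix.ofMatrix_apply, Matrix.of_apply, hentry,
      star_sum, E.right_star]
  · have : ∑ p, ∑ q, star (b p) * E.rightInner (x p) ((star N * N) (k p) (k q) • x q) * b q =
        ∑ m, E.rightInner (∑ p, N m (k p) • MulOpposite.op (b p) • x p)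
          (∑ q, N m (k q) • MulOpposite.op (b q) • x q) := by
      simp only [E.rightInner_sum, E.sum_rightInner]
      rw [Finset.sum_comm]
      conv_rhs => rw [Finset.sum_comm]
      refine Finset.sum_congr rfl fun q _ => ?_
      rw [Finset.sum_comm]
      refine Finset.sum_congr rfl fun p _ => ?_
      rw [← hentry, E.op_smul_rightInner, E.smul_comm, E.right_smul, mul_assoc]
    simp only [CStarMatrix.ofMatrix_apply, Matrix.of_apply]
    rw [this]
    exact Finset.sum_nonneg fun m _ => E.right_nonneg _

end EquivalenceBimodule

/-! ### Operator matrices on `Kⁿ` -/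

section OperatorMatrix

variable {n : ℕ} {K : Type t} [NormedAddCommGroup K] [InnerProductSpace ℂ K]

theorem inner_operatorOfMatrix (T : Fin n → Fin n → (K →L[ℂ] K))
    (ξ η : PiLp 2 fun _ : Fin n => K) :
    ⟪ξ, operatorOfMatrix T η⟫_ℂ = ∑ i, ∑ j, ⟪ξ i, T i j (η j)⟫_ℂ := by
  simp [PiLp.inner_apply, operatorOfMatrix_apply, inner_sum]

/-- The inclusion of the `i`-th summand of `Kⁿ`. -/
noncomputable def summandInclusion (i : Fin n) : K →L[ℂ] PiLp 2 fun _ : Fin n => K :=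
  ((PiLp.continuousLinearEquiv 2 ℂ (fun _ : Fin n => K)).symm :
      (Fin n → K) →L[ℂ] PiLp 2 (fun _ : Fin n => K)).comp
    (ContinuousLinearMap.single ℂ (fun _ => K) i)

theorem summandInclusion_apply (i j : Fin n) (ξ : K) :
    summandInclusion i ξ j = (Pi.single i ξ : Fin n → K) j := by
  simp [summandInclusion, Pi.single_apply]

theorem sum_summandInclusion (ξ : PiLp 2 fun _ : Fin n => K) :
    ∑ i, summandInclusion i (ξ i) = ξ := by
  ext j
  simp [summandInclusion_apply, Finset.sum_pi_single]

theorem inner_operatorOfMatrix_summandInclusion (T : Fin n → Fin n → (K →L[ℂ] K)) (i j : Fin n)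
    (ξ η : K) :
    ⟪summandInclusion i ξ, operatorOfMatrix T (summandInclusion j η)⟫_ℂ = ⟪ξ, T i j η⟫_ℂ := by
  rw [inner_operatorOfMatrix, Finset.sum_eq_single i, Finset.sum_eq_single j]
  · simp [summandInclusion_apply]
  · intro l _ hl
    simp [summandInclusion_apply, hl]
  · simp
  · intro l _ hl
    simp [summandInclusion_apply, hl]
  · simp

end OperatorMatrix

/-! ### The induced completely positive map -/

namespace EquivalenceBimodule

variable {A : Type u} {B : Type v} {X : Type w}
  [CStarAlgebra A] [PartialOrder A] [StarOrderedRing A]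
  [CStarAlgebra B] [PartialOrder B] [StarOrderedRing B]
  [NormedAddCommGroup X] [NormedSpace ℂ X] [Module A X] [Module Bᵐᵒᵖ X]
  (E : EquivalenceBimodule A B X) {n : ℕ}
  {K : Type t} [NormedAddCommGroup K] [InnerProductSpace ℂ K] [CompleteSpace K]

/-- The completely positive map `a ↦ [ψ ⟨u i, a · u j⟩]` on `A` induced from `ψ` by a finite
family in the bimodule. -/
noncomputable def inducedCP (u : Fin n → X) (ψ : B →CP (K →L[ℂ] K)) :
    A →CP (PiLp 2 (fun _ : Fin n => K) →L[ℂ] PiLp 2 (fun _ : Fin n => K)) where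
  toFun a := operatorOfMatrix fun i j => ψ (E.rightInner (u i) (a • u j))
  map_add' a b := by
    ext ξ i
    simp [operatorOfMatrix_apply, add_smul, E.right_add, Finset.sum_add_distrib]
  map_smul' c a := by
    ext ξ i
    simp [operatorOfMatrix_apply, E.complex_smul_left, E.rightInner_smul, Finset.smul_sum]
  map_cstarMatrix_nonneg' k M hM := by
    refine CStarMatrix.nonneg_of_re_sum_inner_nonneg ?_ fun ξ => ?_
    · have hMs : star M = M := (IsSelfAdjoint.of_nonneg hM).star_eq
      ext1 p q
      rw [CStarMatrix.star_apply, CStarMatrix.map_apply, CStarMatrix.map_apply,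
        ContinuousLinearMap.star_eq_adjoint]
      ext1 η
      refine ext_inner_left ℂ fun ζ => ?_
      rw [ContinuousLinearMap.adjoint_inner_right, ← inner_conj_symm]
      simp only [LinearMap.coe_mk, AddHom.coe_mk, inner_operatorOfMatrix, map_sum, inner_conj_symm]
      rw [Finset.sum_comm]
      refine Finset.sum_congr rfl fun i _ => Finset.sum_congr rfl fun j _ => ?_
      rw [← ContinuousLinearMap.adjoint_inner_right, ← ContinuousLinearMap.star_eq_adjoint,
        ← map_star ψ, E.right_star, E.right_adjoint, ← CStarMatrix.star_apply, hMs]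
    -- A `k × k` matrix of `n × n` blocks is read as one matrix indexed by `Fin k × Fin n`, with
    -- entries `ψ ⟨u i, M p q · u j⟩`.
    · have h := ψ.re_sum_inner_nonneg (E.matrix_rightInner_nonneg hM
        (fun p : Fin k × Fin n => p.1) fun p => u p.2) fun p => ξ p.1 p.2
      refine h.trans_eq (congrArg _ ?_)
      simp only [Fintype.sum_prod_type, CStarMatrix.map_apply, LinearMap.coe_mk, AddHom.coe_mk,
        inner_operatorOfMatrix, CStarMatrix.ofMatrix_apply, Matrix.of_apply]
      exact Finset.sum_congr rfl fun p _ => Finset.sum_comm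

theorem inducedCP_apply (u : Fin n → X) (ψ : B →CP (K →L[ℂ] K)) (a : A) :
    E.inducedCP u ψ a = operatorOfMatrix fun i j => ψ (E.rightInner (u i) (a • u j)) := rfl

end EquivalenceBimodule

/-! ### Representing the bimodule between the two dilations -/

namespace EquivalenceBimodule

variable {A : Type u} {B : Type v} {X : Type w}
  [CStarAlgebra A] [PartialOrder A] [StarOrderedRing A]
  [CStarAlgebra B] [PartialOrder B] [StarOrderedRing B]
  [NormedAddCommGroup X] [NormedSpace ℂ X] [Module A X] [Module Bᵐᵒᵖ X]
  (E : EquivalenceBimodule A B X) {n : ℕ} {u : Fin n → X}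
  {K : Type t} [NormedAddCommGroup K] [InnerProductSpace ℂ K]
  {H : Type t₁} [NormedAddCommGroup H] [InnerProductSpace ℂ H] [CompleteSpace H]

/-- The operator `ξ ↦ x ⊗ V ξ` from `K` to the representation space of the induced map, written
in terms of the columns `W i` of the Stinespring operator. -/
noncomputable def tensorOperator (u : Fin n → X) (π : A →⋆ₙₐ[ℂ] (H →L[ℂ] H))
    (W : Fin n → K →L[ℂ] H) : X →ₗ[ℂ] (K →L[ℂ] H) where
  toFun x := ∑ i, (π (E.leftInner x (u i))).comp (W i)
  map_add' x y := by
    simp [E.left_add, ContinuousLinearMap.add_comp, Finset.sum_add_distrib]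
  map_smul' c x := by
    have h (i : Fin n) : E.leftInner (c • x) (u i) = c • E.leftInner x (u i) :=
      map_smul (E.leftInnerₗ (u i)) c x
    simp [h, ContinuousLinearMap.smul_comp, Finset.smul_sum]

variable {π : A →⋆ₙₐ[ℂ] (H →L[ℂ] H)} {W : Fin n → K →L[ℂ] H}

theorem tensorOperator_apply (x : X) (ξ : K) :
    E.tensorOperator u π W x ξ = ∑ i, π (E.leftInner x (u i)) (W i ξ) := by
  simp [tensorOperator, sum_apply]

theorem map_tensorOperator (a : A) (x : X) (ξ : K) :
    π a (E.tensorOperator u π W x ξ) = E.tensorOperator u π W (a • x) ξ := by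
  simp [tensorOperator_apply, E.left_smul]

variable [CompleteSpace K] {ψ : B →CP (K →L[ℂ] K)}

/-- Hypothesis `hW` is the dilation identity of the induced map, read on columns. The basis
expansion of `x` reassembles its terms. -/
theorem inner_tensorOperator_map (hu : E.IsLeftBasis u)
    (hW : ∀ a b i j ξ η, ⟪π a (W i ξ), π b (W j η)⟫_ℂ =
      ⟪ξ, ψ (E.rightInner (u i) ((star a * b) • u j)) η⟫_ℂ)
    (x : X) (b : A) (j : Fin n) (ξ η : K) :
    ⟪E.tensorOperator u π W x ξ, π b (W j η)⟫_ℂ = ⟪ξ, ψ (E.rightInner x (b • u j)) η⟫_ℂ := by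
  conv_rhs => rw [hu x]
  rw [tensorOperator_apply, sum_inner, E.sum_rightInner, map_sum, sum_apply, inner_sum]
  refine Finset.sum_congr rfl fun i _ => ?_
  rw [hW, E.right_adjoint, mul_smul]

theorem inner_tensorOperator (hu : E.IsLeftBasis u)
    (hW : ∀ a b i j ξ η, ⟪π a (W i ξ), π b (W j η)⟫_ℂ =
      ⟪ξ, ψ (E.rightInner (u i) ((star a * b) • u j)) η⟫_ℂ)
    (x y : X) (ξ η : K) :
    ⟪E.tensorOperator u π W x ξ, E.tensorOperator u π W y η⟫_ℂ =
      ⟪ξ, ψ (E.rightInner x y) η⟫_ℂ := by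
  conv_rhs => rw [hu y]
  rw [E.tensorOperator_apply y, inner_sum, E.rightInner_sum, map_sum, sum_apply, inner_sum]
  exact Finset.sum_congr rfl fun i _ => E.inner_tensorOperator_map hu hW _ _ _ _ _

/-- One has `T (a · u i) = π a W i`, because both sides have the same inner products with the total
family of all `π b W j`. -/
theorem isTotalFamily_tensorOperator (hu : E.IsLeftBasis u)
    (hW : ∀ a b i j ξ η, ⟪π a (W i ξ), π b (W j η)⟫_ℂ =
      ⟪ξ, ψ (E.rightInner (u i) ((star a * b) • u j)) η⟫_ℂ)
    (htot : IsTotalFamily fun p : A × Fin n => (π p.1).comp (W p.2)) :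
    IsTotalFamily (E.tensorOperator u π W) := by
  refine htot.mono (Submodule.span_mono ?_)
  rintro _ ⟨⟨a, i⟩, ξ, rfl⟩
  refine ⟨a • u i, ξ, htot.eq_of_inner fun ⟨b, j⟩ η => ?_⟩
  simp only [ContinuousLinearMap.comp_apply]
  rw [E.inner_tensorOperator_map hu hW, hW, E.right_adjoint, mul_smul]

variable {L : Type t₂} [NormedAddCommGroup L] [InnerProductSpace ℂ L] [CompleteSpace L]
  {ρ : B →⋆ₙₐ[ℂ] (L →L[ℂ] L)} {V : K →L[ℂ] L}

/-- If `T x : K → H` are operators with `T x ⋆ T y = ψ ⟨x, y⟩` and total ranges, on which a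
representation of `A` acts through the bimodule, then this representation is strongly Morita
equivalent to the one in a minimal Stinespring representation of `ψ`. -/
theorem exists_isRepresentation (hρ : IsMinimalStinespring ψ ρ V) (T : X →ₗ[ℂ] (K →L[ℂ] H))
    (hπ : IsNondegenerateRep π) (hT : ∀ x y ξ η, ⟪T x ξ, T y η⟫_ℂ = ⟪ξ, ψ (E.rightInner x y) η⟫_ℂ)
    (hTtot : IsTotalFamily T) (hπT : ∀ a x ξ, π a (T x ξ) = T (a • x) ξ) :
    ∃ πX : X →ₗ[ℂ] (L →L[ℂ] H), E.IsRepresentation π πX ρ := by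
  have hV := hρ.isTotalFamily
  have hinner (x y : X) (b c : B) (ξ η : K) :
      ⟪T (MulOpposite.op b • x) ξ, T (MulOpposite.op c • y) η⟫_ℂ =
        ⟪ρ b (V ξ), ρ (E.rightInner x y) (ρ c (V η))⟫_ℂ := by
    rw [hT, ← mul_apply_eq_comp, ← map_mul, hρ.inner_eq, E.op_smul_rightInner, E.right_smul]
  -- The operator `ℓ ↦ x ⊗ ℓ` must send `ρ b (V ξ)` to `T (x · b) ξ`; it is bounded because `‖x ⊗
  -- ℓ‖² = ⟪ℓ, ρ ⟨x, x⟩ ℓ⟫`.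
  have hbound (x : X) (z : B →₀ K) :
      ‖familySum (fun b => T (MulOpposite.op b • x)) z‖ ≤
        √‖ρ (E.rightInner x x)‖ * ‖familySum (fun b => (ρ b).comp V) z‖ := by
    have hsq : ⟪familySum (fun b => T (MulOpposite.op b • x)) z,
        familySum (fun b => T (MulOpposite.op b • x)) z⟫_ℂ =
        ⟪familySum (fun b => (ρ b).comp V) z,
          ρ (E.rightInner x x) (familySum (fun b => (ρ b).comp V) z)⟫_ℂ := by
      rw [comp_familySum, inner_familySum, inner_familySum]
      exact Finset.sum_congr rfl fun b _ => Finset.sum_congr rfl fun c _ => hinner _ _ _ _ _ _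
    refine le_of_sq_le_sq ?_ (by positivity)
    rw [mul_pow, Real.sq_sqrt (norm_nonneg _), ← inner_self_eq_norm_sq (𝕜 := ℂ), hsq]
    calc _ ≤ _ := (Complex.re_le_norm _).trans (norm_inner_le_norm _ _)
      _ ≤ ‖familySum (fun b => (ρ b).comp V) z‖ *
          (‖ρ (E.rightInner x x)‖ * ‖familySum (fun b => (ρ b).comp V) z‖) := by
        gcongr
        exact ContinuousLinearMap.le_opNorm _ _
      _ = _ := by ring
  choose P hP using fun x => hV.exists_extension _ _ (hbound x)
  simp only [ContinuousLinearMap.comp_apply] at hP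
  have hP_one (x : X) (ξ : K) : P x (V ξ) = T x ξ := by
    have := hP x 1 ξ
    rwa [hρ.map_one, MulOpposite.op_one, one_smul] at this
  have hadj (x y : X) : (ContinuousLinearMap.adjoint (P x)).comp (P y) = ρ (E.rightInner x y) :=
    hV.ext_inner hV fun c η b ξ => by
      simp only [ContinuousLinearMap.comp_apply]
      rw [ContinuousLinearMap.adjoint_inner_left, hP, hP, ← inner_conj_symm, hinner,
        inner_conj_symm]
  refine ⟨{ toFun := P, map_add' := fun x y => hV.ext fun b ξ => ?_,
            map_smul' := fun c x => hV.ext fun b ξ => ?_ },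
    hπ, hρ.isNondegenerateRep, fun x y => hTtot.ext fun z ξ => ?_, hadj,
    fun a x b => hV.ext fun c ξ => ?_⟩
  · simp [hP]
  · simp [hP, E.op_smul_complex_smul]
  -- On `T z ξ = P z (V ξ)`, the product `P x (P y)⋆` gives `T (x · ⟨y, z⟩) ξ`, which is `T (⟨x, y⟩
  -- · z) ξ` by the linking identity.
  · have h := congrArg (fun f => f (V ξ)) (hadj y z)
    simp only [ContinuousLinearMap.comp_apply] at h
    simp only [LinearMap.coe_mk, AddHom.coe_mk, ContinuousLinearMap.comp_apply]
    rw [← hP_one z, h, hP, hP_one, hπT, E.linking]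
  · simp only [LinearMap.coe_mk, AddHom.coe_mk, ContinuousLinearMap.comp_apply]
    rw [hP, ← mul_apply_eq_comp, ← map_mul, hP, hπT, E.smul_comm, E.smul_comm, smul_smul,
      MulOpposite.op_mul]

end EquivalenceBimodule

/-! ### The main theorem -/

theorem theorem6p5 {A : Type u} {B : Type v} {X : Type w}
    [CStarAlgebra A] [PartialOrder A] [StarOrderedRing A]
    [CStarAlgebra B] [PartialOrder B] [StarOrderedRing B]
    [NormedAddCommGroup X] [NormedSpace ℂ X] [Module A X] [Module Bᵐᵒᵖ X]
    (E : EquivalenceBimodule A B X)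
    {n : ℕ} (u : Fin n → X) (hu : E.IsLeftBasis u)
    {K : Type t} [NormedAddCommGroup K] [InnerProductSpace ℂ K] [CompleteSpace K]
    (ψ : B →CP (K →L[ℂ] K)) :
    ∃ φ : A →CP (PiLp 2 (fun _ : Fin n => K) →L[ℂ] PiLp 2 (fun _ : Fin n => K)),
      (∀ a : A, φ a = operatorOfMatrix (fun i j => ψ (E.rightInner (u i) (a • u j)))) ∧
      CPStronglyMoritaEquivalent.{u, v, w} φ ψ := by
  obtain ⟨H, _, _, _, π, V, hπ⟩ := (E.inducedCP u ψ).exists_isMinimalStinespring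
  obtain ⟨L, _, _, _, ρ, U, hρ⟩ := ψ.exists_isMinimalStinespring
  let W : Fin n → K →L[ℂ] H := fun i => V.comp (summandInclusion i)
  have hW (a b i j ξ η) : ⟪π a (W i ξ), π b (W j η)⟫_ℂ =
      ⟪ξ, ψ (E.rightInner (u i) ((star a * b) • u j)) η⟫_ℂ := by
    simp only [W, ContinuousLinearMap.comp_apply]
    rw [hπ.inner_eq, E.inducedCP_apply, inner_operatorOfMatrix_summandInclusion]
  have htot : IsTotalFamily fun p : A × Fin n => (π p.1).comp (W p.2) := by
    refine hπ.minimal.mono (SetLike.coe_subset_coe.mpr (Submodule.span_le.mpr ?_))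
    rintro _ ⟨a, ξ, rfl⟩
    rw [← sum_summandInclusion ξ, map_sum, map_sum]
    exact sum_mem fun i _ => Submodule.subset_span ⟨(a, i), ξ i, rfl⟩
  obtain ⟨πX, hX⟩ := E.exists_isRepresentation hρ (E.tensorOperator u π W)
    hπ.isNondegenerateRep (E.inner_tensorOperator hu hW)
    (E.isTotalFamily_tensorOperator hu hW htot) E.map_tensorOperator
  -- The given bimodule `X` itself implements the equivalence.
  exact ⟨E.inducedCP u ψ, E.inducedCP_apply u ψ, H, _, _, _, π, V, L, _, _, _, ρ, U, hπ, hρ,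
    X, _, _, _, _, E, πX, hX⟩
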